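/- **Setting.** Let $n\ge 0$. A dyad is a pair $(i,j)$ with $1\le i<j\le n$. Write a vector of dyadic probabilities as $p=(p_{i,j}(a,b))\in\mathbb{R}^{2n(n-1)}$, indexed by dyads $(i,j)$ and $a,b\in\{0,1\}$, and let $D_n$ be the set of those $p$ for which each $p_{i,j}=(p_{i,j}(a,b))_{a,b}$ lies in the standard simplex $\Delta_3\subset\mathbb{R}^4$. The $p_1$ model has real parameters $\lambda_{i,j}$ $(i<j)$, $\theta$, $\alpha_i$, $\beta_i$, and reciprocity parameters, with $$\log p_{i,j}(a,b)=\lambda_{i,j}+a(\alpha_i+\beta_j)+b(\alpha_j+\beta_i)+(a+b)\theta+\min(a,b)\,\rho_{i,j},$$ where one of the following specifications is fixed: $\rho_{i,j}=0$; $\rho_{i,j}=\rho$; $\rho_{i,j}=\rho+\rho_i+\rho_j$; or the $\rho_{i,j}$ are free. Let $A$ be the design matrix: its rows are indexed by the parameters, its columns $a_k$ by the coordinates $k$ of $p$, and these equations read $\log p=A^\top\zeta$ with $\zeta$ the parameter vector. Define: * the model $M_A=\{p\in D_n : p>0,\ \log p=A^\top\zeta\text{ for some real }\zeta\}$, with topological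 closure $\overline{M_A}$; * $S_A=V_A\cap D_n$, where $V_A$ is the set of non-negative real zeros of the toric ideal of $A$ (the kernel of $p_k\mapsto\prod_l z_l^{A_{lk}}$); * the marginal polytope $P_A=\{Ap : p\in D_n\}$ and the marginal cone $C_A=\mathrm{cone}(A)=\{Ax : x\ge 0\}$; * the moment map $\mu:S_A\to P_A$, $\mu(p)=Ap$; * facial sets of $C_A$: sets $\mathcal F$ of column indices for which some vector $c$ satisfies $c^\top a_k=0$ for $k\in\mathcal F$ and $c^\top a_k<0$ for $k\notin\mathcal F$; * faces of $P_A$: non-empty sets of maximizers over $P_A$ of a linear functional ($P_A$ itself included). For data $x\in D_n$ (in particular for an observed network, where each $x_{i,j}$ is a vertex of $\Delta_3$) the likelihood is $\ell_x(p)=\prod_{i<j}\prod_{a,b}p_{i,j}(a,b)^{x_{i,j}(a,b)}$, with $0^0=1$. The MLE exists for $x$ if $\ell_x$ attains its maximum over $M_A$; the extended MLE for $x$ is the unique maximizer of $\ell_x$ over $\overline{M_A}$. Write $\mathrm{ri}$ for relative interior and $\mathrm{supp}(p)=\{k : p_k\ne0\}$. **Theorem 3.3.** 1. For every $t\in P_A$: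 $t\in\mathrm{ri}(P_A)$ if and only if $t\in\mathrm{ri}(C_A)$. 2. For every $t\in P_A$ and every $x\in D_n$ with $Ax=t$, the MLE exists for $x$ if and only if $t\in\mathrm{ri}(C_A)$. 3. The moment map $\mu:S_A\to P_A$ is a bijection, and for every $t\in P_A$ and every $x\in D_n$ with $Ax=t$, the extended MLE for $x$ exists and equals $\mu^{-1}(t)$. 4. For every face $G$ of $P_A$ there is exactly one facial set $\mathcal F$ of $C_A$ such that $\mathcal F=\mathrm{supp}(\mu^{-1}(t))$ for every $t\in\mathrm{ri}(G)$. -/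

import Mathlib

open Matrix

noncomputable section

namespace P1

/-- The dyads of an `n`-node network: pairs of nodes `(i, j)` with `i < j`. -/
abbrev Dyad (n : ℕ) : Type := {e : Fin n × Fin n // e.1 < e.2}

/-- The `2n(n-1)` coordinates of a vector of dyadic probabilities: `(d, (a, b))` with `d = (i, j)`
is the coordinate `p_{i,j}(a, b)`; `a = 1` means that there is an edge `i → j` and `b = 1` that
there is an edge `j → i`. -/
abbrev Cell (n : ℕ) : Type := Dyad n × (Fin 2 × Fin 2)

/-- The ways in which the reciprocity parameters `ρ_{i,j}` are modelled. -/
inductive Reciprocity : Type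
  /-- `ρ_{i,j} = 0` -/
  | zero
  /-- `ρ_{i,j} = ρ` -/
  | constant
  /-- `ρ_{i,j} = ρ + ρ_i + ρ_j` -/
  | edgeDependent
  /-- the `ρ_{i,j}`, `i < j`, are free parameters -/
  | unrestricted

/-- The parameters through which the `ρ_{i,j}` are expressed: none; `ρ`; `ρ` (`none`) together with
the `ρ_i` (`some i`); all the `ρ_{i,j}`. -/
abbrev RecipParam (n : ℕ) : Reciprocity → Type
  | .zero => Empty
  | .constant => Unit
  | .edgeDependent => Option (Fin n)
  | .unrestricted => Dyad n

instance (n : ℕ) (R : Reciprocity) : Fintype (RecipParam n R) := by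
  cases R
  · exact (inferInstance : Fintype Empty)
  · exact (inferInstance : Fintype Unit)
  · exact (inferInstance : Fintype (Option (Fin n)))
  · exact (inferInstance : Fintype (Dyad n))

/-- The coefficient of a reciprocity parameter in the expression of `ρ_d`, for a dyad `d`. -/
def recipCoeff (n : ℕ) : (R : Reciprocity) → RecipParam n R → Dyad n → ℕ
  | .zero, k, _ => Empty.elim k
  | .constant, _, _ => 1
  | .edgeDependent, none, _ => 1
  | .edgeDependent, some i, d => (if i = d.1.1 then 1 else 0) + (if i = d.1.2 then 1 else 0)
  | .unrestricted, d', d => if d' = d then 1 else 0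

/-- The model parameters, in this order: `λ_{i,j}` (`i < j`), `θ`, `α_i`, `β_i`, and the
reciprocity parameters. -/
abbrev Param (n : ℕ) (R : Reciprocity) : Type :=
  Dyad n ⊕ Unit ⊕ Fin n ⊕ Fin n ⊕ RecipParam n R

/-- The coefficients of the model parameters in the Holland-Leinhardt equations
`log p_{i,j}(a, b) = λ_{i,j} + a (α_i + β_j) + b (α_j + β_i) + (a + b) θ + min(a, b) ρ_{i,j}`. -/
def designNat (n : ℕ) (R : Reciprocity) : Matrix (Param n R) (Cell n) ℕ
  | .inl d', (d, _) => if d' = d then 1 else 0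
  | .inr (.inl _), (_, (a, b)) => (a : ℕ) + (b : ℕ)
  | .inr (.inr (.inl i)), (d, (a, b)) =>
      (if i = d.1.1 then (a : ℕ) else 0) + (if i = d.1.2 then (b : ℕ) else 0)
  | .inr (.inr (.inr (.inl i))), (d, (a, b)) =>
      (if i = d.1.1 then (b : ℕ) else 0) + (if i = d.1.2 then (a : ℕ) else 0)
  | .inr (.inr (.inr (.inr k))), (d, (a, b)) => min (a : ℕ) (b : ℕ) * recipCoeff n R k d

/-- The design matrix `A`. Its rows are indexed by the parameters, its columns by the cells. -/
def design (n : ℕ) (R : Reciprocity) : Matrix (Param n R) (Cell n) ℝ :=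
  (designNat n R).map (fun m : ℕ => (m : ℝ))

/-- `D_n`: the vectors `(p_{i,j})_{i < j}` with each `p_{i,j}` in the standard simplex `Δ_3`. The
observed networks are the points `x` of `D_n` for which each `x_{i,j}` is a vertex of `Δ_3`. -/
def dyadSimplex (n : ℕ) : Set (Cell n → ℝ) :=
  {p | ∀ d : Dyad n, (fun s => p (d, s)) ∈ stdSimplex ℝ (Fin 2 × Fin 2)}

/-- `M_A`: the `p_1` model, that is the strictly positive points of `D_n` that satisfy the
Holland-Leinhardt equations `log p = Aᵀ ζ` for some real parameter vector `ζ`. -/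
def model (n : ℕ) (R : Reciprocity) : Set (Cell n → ℝ) :=
  {p | p ∈ dyadSimplex n ∧ (∀ k, 0 < p k) ∧
    ∃ ζ : Param n R → ℝ, ∀ k, Real.log (p k) = ((design n R)ᵀ *ᵥ ζ) k}

/-- The toric ideal `I_A`: the kernel of `p_k ↦ ∏_l z_l ^ A_{l k}`. -/
def toricIdeal (n : ℕ) (R : Reciprocity) : Ideal (MvPolynomial (Cell n) ℝ) :=
  RingHom.ker (MvPolynomial.aeval (R := ℝ)
    (fun k : Cell n => ∏ l : Param n R,
      (MvPolynomial.X l : MvPolynomial (Param n R) ℝ) ^ designNat n R l k))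

/-- `V_A`: the non-negative points of the toric variety. -/
def toricVariety (n : ℕ) (R : Reciprocity) : Set (Cell n → ℝ) :=
  {p | (∀ k, 0 ≤ p k) ∧ ∀ f ∈ toricIdeal n R, MvPolynomial.eval p f = 0}

/-- `S_A = V_A ∩ D_n`. -/
def closedModel (n : ℕ) (R : Reciprocity) : Set (Cell n → ℝ) :=
  toricVariety n R ∩ dyadSimplex n

/-- The map `p ↦ A p`. -/
def moment (n : ℕ) (R : Reciprocity) (p : Cell n → ℝ) : Param n R → ℝ :=
  design n R *ᵥ p

/-- The marginal polytope `P_A`. -/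
def marginalPolytope (n : ℕ) (R : Reciprocity) : Set (Param n R → ℝ) :=
  {t | ∃ p ∈ dyadSimplex n, t = moment n R p}

/-- The marginal cone `C_A = cone(A)`: the non-negative combinations of the columns of `A`. -/
def marginalCone (n : ℕ) (R : Reciprocity) : Set (Param n R → ℝ) :=
  {t | ∃ x : Cell n → ℝ, (∀ k, 0 ≤ x k) ∧ t = design n R *ᵥ x}

/-- `μ⁻¹(t)`, for the moment map `μ : S_A → P_A`, `p ↦ A p`. -/
def momentInv (n : ℕ) (R : Reciprocity) (t : Param n R → ℝ) : Cell n → ℝ :=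
  Function.invFunOn (moment n R) (closedModel n R) t

/-- The facial sets of `C_A`. -/
def IsFacialSet (n : ℕ) (R : Reciprocity) (F : Set (Cell n)) : Prop :=
  ∃ c : Param n R → ℝ,
    (∀ k ∈ F, c ⬝ᵥ (fun l => design n R l k) = 0) ∧
    (∀ k ∉ F, c ⬝ᵥ (fun l => design n R l k) < 0)

/-- The (non-empty) faces of the polytope `P_A`: the sets of maximizers over `P_A` of a linear
functional. -/
def IsFace (n : ℕ) (R : Reciprocity) (G : Set (Param n R → ℝ)) : Prop :=
  G.Nonempty ∧ IsExposed ℝ (marginalPolytope n R) G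

/-- The likelihood `ℓ_x(p) = ∏_{i<j} ∏_{a,b} p_{i,j}(a,b) ^ x_{i,j}(a,b)`, with `0 ^ 0 = 1`.
For an observed network `x` it is the probability of `x` under `p`. -/
def likelihood (n : ℕ) (x p : Cell n → ℝ) : ℝ :=
  ∏ d : Dyad n, ∏ s : Fin 2 × Fin 2, p (d, s) ^ x (d, s)

/-- The MLE exists for the data `x`: the likelihood attains its maximum over `M_A`. -/
def MLEExists (n : ℕ) (R : Reciprocity) (x : Cell n → ℝ) : Prop :=
  ∃ p ∈ model n R, IsMaxOn (likelihood n x) (model n R) p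

/-- `p` is the extended MLE for the data `x`: the unique point of the closure of the model at
which the likelihood attains its supremum. -/
def IsExtendedMLE (n : ℕ) (R : Reciprocity) (x p : Cell n → ℝ) : Prop :=
  p ∈ closure (model n R) ∧
  IsMaxOn (likelihood n x) (closure (model n R)) p ∧
  ∀ q ∈ closure (model n R), IsMaxOn (likelihood n x) (closure (model n R)) q → q = p

end P1

end

/-!
The theorem is the Birch–Barndorff-Nielsen theory of discrete exponential families. Two facts carry
it.

*Points of the toric variety.* A non-negative zero `p` of the toric ideal satisfies `p ^ u = p ^ v`
whenever `A u = A v` for natural vectors `u`, `v`. As the matrix `A` is integral, this extends to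
real kernel vectors `w` of `A` by means of `ℚ`-linear functionals `ℝ → ℚ`: a functional that
preserves the signs of the entries of `w` shows that the support of `p` is facial
(`IsBinomialZero.ne_zero_of_neg`), and the coordinates with respect to a basis of `ℝ` over `ℚ` show
that `log p` is orthogonal to the kernel vectors supported in the support of `p`
(`IsBinomialZero.sum_mul_log`). Together with the Gibbs inequality they imply that a point `p` of
`S_A` with `A p = A x` is the only maximizer of the likelihood of `x` over `S_A`
(`P1.eq_of_likelihood_le`); in particular the moment map is injective on `S_A`.

*Points of the model.* In the fiber `{q ∈ D_n | A q = A x}` of a strictly positive `x`, the point of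
maximal entropy is strictly positive, and its logarithm lies in the row space of `A`, so it belongs
to `M_A` (`P1.exists_mem_model_of_pos`). Compactness then gives a point of the closure of `M_A` in
every fiber (`P1.exists_mem_closure_model`). As the closure of `M_A` is contained in `S_A`, where
the moment map is injective, the two sets agree (`P1.closure_model`).

The statements on relative interiors follow from `Convex.mem_intrinsicInterior_iff`: a point is in
the relative interior of `P_A` or of `C_A` if and only if it is the image of a strictly positive
vector, and it is in the relative interior of a face with facial set `F` only if it is the image of
a point of `D_n` with support `F`.
-/

/-! ### Relative interiors of convex sets -/

/-- Rockafellar's algebraic description of the relative interior of a convex set: every segment of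
the set that ends at a relative interior point can be prolonged beyond that point. -/
theorem Convex.mem_intrinsicInterior_iff {V : Type*} [NormedAddCommGroup V] [NormedSpace ℝ V]
    [FiniteDimensional ℝ V] {s : Set V} (hs : Convex ℝ s) {x : V} :
    x ∈ intrinsicInterior ℝ s ↔
      x ∈ s ∧ ∀ y ∈ s, ∃ ε : ℝ, 0 < ε ∧ x + ε • (x - y) ∈ s := by
  have key : ∀ z : V, z ∈ intrinsicInterior ℝ s ↔
      z ∈ affineSpan ℝ s ∧ ∃ δ : ℝ, 0 < δ ∧ ∀ v ∈ affineSpan ℝ s, dist v z < δ → v ∈ s := by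
    intro z
    rw [mem_intrinsicInterior]
    constructor
    · rintro ⟨y, hy, rfl⟩
      refine ⟨y.2, ?_⟩
      obtain ⟨δ, hδ, h⟩ := Metric.mem_nhds_iff.1 (mem_interior_iff_mem_nhds.1 hy)
      exact ⟨δ, hδ, fun v hv hd => h (show (⟨v, hv⟩ : affineSpan ℝ s) ∈ Metric.ball y δ from hd)⟩
    · rintro ⟨hz, δ, hδ, h⟩
      refine ⟨⟨z, hz⟩, ?_, rfl⟩
      rw [mem_interior_iff_mem_nhds, Metric.mem_nhds_iff]
      exact ⟨δ, hδ, fun v hv => h v v.2 hv⟩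
  constructor
  · intro hx
    refine ⟨intrinsicInterior_subset hx, fun y hy => ?_⟩
    obtain ⟨hxs, δ, hδ, h⟩ := (key x).1 hx
    have hN : 0 < ‖x - y‖ + 1 := by positivity
    refine ⟨δ / (‖x - y‖ + 1), by positivity, h _ ?_ ?_⟩
    · have := AffineMap.lineMap_mem (-(δ / (‖x - y‖ + 1))) hxs (subset_affineSpan ℝ s hy)
      rw [AffineMap.lineMap_apply_module'] at this
      convert this using 1
      module
    · rw [dist_eq_norm, add_sub_cancel_left, norm_smul, Real.norm_of_nonneg (by positivity),
        div_mul_eq_mul_div, div_lt_iff₀ hN]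
      nlinarith
  · rintro ⟨hx, h⟩
    obtain ⟨z, hz⟩ := Set.Nonempty.intrinsicInterior hs ⟨x, hx⟩
    have hzs := intrinsicInterior_subset hz
    obtain ⟨-, δ, hδ, hball⟩ := (key z).1 hz
    obtain ⟨ε, hε, hw⟩ := h z hzs
    have hc : 0 < (1 + ε) / ε := by positivity
    -- the homothety that maps `z` to `x` and fixes `x + ε • (x - z)` carries a ball of the
    -- affine span around `z` that lies in `s` to such a ball around `x`
    refine (key x).2 ⟨subset_affineSpan ℝ s hx, δ / ((1 + ε) / ε), by positivity, fun v hv hd => ?_⟩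
    have hv' : z + ((1 + ε) / ε) • (v - x) ∈ s := by
      refine hball _ ?_ ?_
      · have := AffineSubspace.vadd_mem_of_mem_direction
          (Submodule.smul_mem _ ((1 + ε) / ε)
            (AffineSubspace.vsub_mem_direction hv (subset_affineSpan ℝ s hx)))
          (subset_affineSpan ℝ s hzs)
        simpa [add_comm] using this
      · rw [dist_eq_norm, add_sub_cancel_left, norm_smul, Real.norm_of_nonneg hc.le]
        rw [lt_div_iff₀ hc, dist_eq_norm] at hd
        linarith
    have hcomb := hs hv' hw (show 0 ≤ ε / (1 + ε) by positivity)
      (show 0 ≤ 1 / (1 + ε) by positivity) (by field_simp; ring)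
    convert hcomb using 1
    match_scalars <;> field_simp <;> ring

/-! ### Real kernel vectors of an integer matrix -/

/-- The signs of finitely many real numbers are preserved by some `ℚ`-linear functional `ℝ → ℚ`. -/
theorem exists_ratLinearMap_sign {K : Type*} [Finite K] (w : K → ℝ) :
    ∃ φ : ℝ →ₗ[ℚ] ℚ, ∀ k, (0 < w k → 0 < φ (w k)) ∧ (w k < 0 → φ (w k) < 0) := by
  let B := Module.Basis.ofVectorSpace ℚ ℝ
  -- evaluation at a real family `r` replaces the basis vectors by the numbers `r i`; the conditions
  -- on `r` are open, and `r = B` satisfies them, hence so does a rational family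
  let ev : (Module.Basis.ofVectorSpaceIndex ℚ ℝ → ℝ) → ℝ → ℝ :=
    fun r x => (B.repr x).sum fun i c => (c : ℝ) * r i
  have hev : ∀ x, Continuous fun r => ev r x := fun x =>
    continuous_finsetSum _ fun i _ => continuous_const.mul (continuous_apply i)
  have hB : ∀ x, ev B x = x := fun x => by
    conv_rhs => rw [← B.linearCombination_repr x]
    simp [ev, Finsupp.linearCombination_apply, Rat.smul_def]
  let U : Set (Module.Basis.ofVectorSpaceIndex ℚ ℝ → ℝ) :=
    ⋂ k, {r | 0 < w k → 0 < ev r (w k)} ∩ {r | w k < 0 → ev r (w k) < 0}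
  have hU : IsOpen U := by
    refine isOpen_iInter_of_finite fun k => IsOpen.inter ?_ ?_
    · by_cases h : 0 < w k
      · simpa [h] using isOpen_lt continuous_const (hev (w k))
      · simp [h]
    · by_cases h : w k < 0
      · simpa [h] using isOpen_lt (hev (w k)) continuous_const
      · simp [h]
  have hBU : (B : _ → ℝ) ∈ U := by
    simp [U, hB]
  obtain ⟨q, hq⟩ := (DenseRange.piMap (f := fun _ : Module.Basis.ofVectorSpaceIndex ℚ ℝ =>
    ((↑) : ℚ → ℝ)) fun _ => Rat.denseRange_cast).exists_mem_open hU ⟨_, hBU⟩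
  have hφ : ∀ x, ((B.constr ℚ q x : ℚ) : ℝ) = ev (Pi.map (fun _ => ((↑) : ℚ → ℝ)) q) x := by
    intro x
    simp [B.constr_apply, ev, Finsupp.sum, Pi.map]
  refine ⟨B.constr ℚ q, fun k => ?_⟩
  have := Set.mem_iInter.1 hq k
  exact ⟨fun h => by exact_mod_cast (hφ (w k)).symm ▸ this.1 h,
    fun h => by exact_mod_cast (hφ (w k)).symm ▸ this.2 h⟩

/-- The image of a real kernel vector of a natural number matrix under a `ℚ`-linear functional has
an integer multiple in the kernel. -/
theorem exists_int_kernel_of_ratLinearMap {L K : Type*} [Fintype K] (A : Matrix L K ℕ)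
    {w : K → ℝ} (hw : A.map (fun m : ℕ => (m : ℝ)) *ᵥ w = 0) (φ : ℝ →ₗ[ℚ] ℚ) :
    ∃ N : ℕ, 0 < N ∧ ∃ z : K → ℤ, (∀ k, (z k : ℚ) = N * φ (w k)) ∧
      ∀ l, ∑ k, (A l k : ℤ) * z k = 0 := by
  have hz : ∀ k, ∃ z : ℤ, (z : ℚ) = ((∏ j, (φ (w j)).den : ℕ) : ℚ) * φ (w k) := by
    intro k
    obtain ⟨m, hm⟩ := Finset.dvd_prod_of_mem (fun j => (φ (w j)).den) (Finset.mem_univ k)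
    refine ⟨m * (φ (w k)).num, ?_⟩
    rw [hm]
    push_cast
    rw [mul_right_comm, Rat.den_mul_eq_num, mul_comm]
  choose z hz using hz
  refine ⟨∏ j, (φ (w j)).den, Finset.prod_pos fun j _ => (φ (w j)).den_pos, z, hz, fun l => ?_⟩
  have h1 : ∑ k, (A l k : ℚ) * φ (w k) = 0 := by
    have h2 : ∑ k, (A l k : ℝ) * w k = 0 := congrFun hw l
    have h3 := congrArg φ h2
    rw [map_sum, map_zero] at h3
    rw [← h3]
    refine Finset.sum_congr rfl fun k _ => ?_
    rw [← nsmul_eq_mul, ← nsmul_eq_mul, map_nsmul]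
  have h4 : ((∑ k, (A l k : ℤ) * z k : ℤ) : ℚ) = 0 := by
    push_cast
    simp_rw [hz]
    rw [← mul_zero ((∏ j, (φ (w j)).den : ℕ) : ℚ), ← h1, Finset.mul_sum]
    exact Finset.sum_congr rfl fun k _ => by ring
  exact_mod_cast h4

/-! ### Zeros of the binomials of a matrix -/

section Binomials

variable {L K : Type*} [Fintype K] {A : Matrix L K ℕ} {p : K → ℝ}

/-- `p` is a zero of all binomials `∏ k, X k ^ u k - ∏ k, X k ^ v k` with `A u = A v`. -/
def IsBinomialZero (A : Matrix L K ℕ) (p : K → ℝ) : Prop :=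
  ∀ u v : K → ℕ, A *ᵥ u = A *ᵥ v → ∏ k, p k ^ u k = ∏ k, p k ^ v k

theorem IsBinomialZero.prod_toNat (hp : IsBinomialZero A p) {z : K → ℤ}
    (hz : ∀ l, ∑ k, (A l k : ℤ) * z k = 0) :
    ∏ k, p k ^ (z k).toNat = ∏ k, p k ^ (-z k).toNat := by
  refine hp (fun k => (z k).toNat) (fun k => (-z k).toNat) ?_
  ext l
  have h : ∑ k, (A l k : ℤ) * ((z k).toNat : ℤ) - ∑ k, (A l k : ℤ) * ((-z k).toNat : ℤ) = 0 := by
    rw [← Finset.sum_sub_distrib, ← hz l]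
    refine Finset.sum_congr rfl fun k _ => ?_
    rw [← mul_sub, Int.toNat_sub_toNat_neg]
  have h' := sub_eq_zero.1 h
  simp only [mulVec, dotProduct]
  exact_mod_cast h'

/-- The support of a binomial zero is facial: a linear relation between the columns of `A` whose
positive part lives on the support has its negative part there, too. -/
theorem IsBinomialZero.ne_zero_of_neg (hp : IsBinomialZero A p) {w : K → ℝ}
    (hw : A.map (fun m : ℕ => (m : ℝ)) *ᵥ w = 0) (hpos : ∀ k, 0 < w k → p k ≠ 0) {k : K}
    (hk : w k < 0) : p k ≠ 0 := by
  obtain ⟨φ, hφ⟩ := exists_ratLinearMap_sign w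
  obtain ⟨N, hN, z, hz, hAz⟩ := exists_int_kernel_of_ratLinearMap A hw φ
  have hNQ : (0 : ℚ) < N := by exact_mod_cast hN
  have hzpos : ∀ j, 0 < z j → 0 < w j := by
    intro j hj
    have hj' : 0 < φ (w j) := by
      have : (0 : ℚ) < z j := by exact_mod_cast hj
      rw [hz j] at this
      exact (mul_pos_iff_of_pos_left hNQ).1 this
    rcases lt_trichotomy (w j) 0 with h | h | h
    · exact absurd ((hφ j).2 h) hj'.not_gt
    · simp [h] at hj'
    · exact h
  have hzk : z k < 0 := by
    have : (z k : ℚ) < 0 := by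
      rw [hz k]
      exact mul_neg_of_pos_of_neg hNQ ((hφ k).2 hk)
    exact_mod_cast this
  intro hpk
  have h1 : ∏ j, p j ^ (-z j).toNat = 0 :=
    Finset.prod_eq_zero (Finset.mem_univ k) (by rw [hpk, zero_pow (by omega)])
  rw [← hp.prod_toNat hAz] at h1
  obtain ⟨j, -, hj⟩ := Finset.prod_eq_zero_iff.1 h1
  rw [pow_eq_zero_iff'] at hj
  exact hpos j (hzpos j (by have := hj.2; omega)) hj.1

/-- On the support of a binomial zero `p`, the vector `log p` is orthogonal to the kernel of `A`. -/
theorem IsBinomialZero.sum_mul_log (hp : IsBinomialZero A p) {w : K → ℝ}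
    (hw : A.map (fun m : ℕ => (m : ℝ)) *ᵥ w = 0) (hsupp : ∀ k, w k ≠ 0 → p k ≠ 0) :
    ∑ k, w k * Real.log (p k) = 0 := by
  have hrat : ∀ φ : ℝ →ₗ[ℚ] ℚ, ∑ k, (φ (w k) : ℝ) * Real.log (p k) = 0 := by
    intro φ
    obtain ⟨N, hN, z, hz, hAz⟩ := exists_int_kernel_of_ratLinearMap A hw φ
    have hNR : (N : ℝ) ≠ 0 := by exact_mod_cast hN.ne'
    have hz0 : ∀ k, p k = 0 → z k = 0 := by
      intro k hk
      have : w k = 0 := by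
        by_contra h
        exact hsupp k h hk
      have h2 := hz k
      rw [this, map_zero, mul_zero] at h2
      exact_mod_cast h2
    have hne : ∀ (f : ℤ → ℕ), f 0 = 0 → ∀ k ∈ Finset.univ, p k ^ f (z k) ≠ 0 := by
      intro f hf k _ h
      obtain ⟨h1, h2⟩ := pow_eq_zero_iff'.1 h
      exact h2 (by rw [hz0 k h1, hf])
    have h1 := congrArg Real.log (hp.prod_toNat hAz)
    rw [Real.log_prod (hne Int.toNat rfl), Real.log_prod (hne (fun m => (-m).toNat) rfl)] at h1
    simp only [Real.log_pow] at h1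
    rw [← sub_eq_zero, ← Finset.sum_sub_distrib] at h1
    refine (mul_eq_zero.1 (?_ : (N : ℝ) * _ = 0)).resolve_left hNR
    rw [← h1, Finset.mul_sum]
    refine Finset.sum_congr rfl fun k _ => ?_
    have h2 : (z k : ℝ) = N * φ (w k) := by exact_mod_cast hz k
    have h3 : (((z k).toNat : ℤ) : ℝ) - (((-z k).toNat : ℤ) : ℝ) = z k := by
      rw [← Int.cast_sub, Int.toNat_sub_toNat_neg]
    push_cast at h3
    rw [← sub_mul, ← mul_assoc, ← h2]
    exact congrArg (· * _) h3.symm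
  -- expand the entries of `w` in a basis of `ℝ` over `ℚ`
  let B := Module.Basis.ofVectorSpace ℚ ℝ
  classical
  let S := Finset.univ.biUnion fun k => (B.repr (w k)).support
  have hexp : ∀ k, w k = ∑ i ∈ S, (B.coord i (w k) : ℝ) * B i := by
    intro k
    conv_lhs => rw [← B.linearCombination_repr (w k), Finsupp.linearCombination_apply]
    rw [Finsupp.sum_of_support_subset (s := S) _
      (Finset.subset_biUnion_of_mem (fun k => (B.repr (w k)).support) (Finset.mem_univ k)) _
      (by simp)]
    simp [Rat.smul_def]
  calc ∑ k, w k * Real.log (p k)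
      = ∑ k, ∑ i ∈ S, (B.coord i (w k) : ℝ) * B i * Real.log (p k) := by
        refine Finset.sum_congr rfl fun k _ => ?_
        conv_lhs => rw [hexp k]
        rw [Finset.sum_mul]
    _ = ∑ i ∈ S, B i * ∑ k, (B.coord i (w k) : ℝ) * Real.log (p k) := by
        rw [Finset.sum_comm]
        refine Finset.sum_congr rfl fun i _ => ?_
        rw [Finset.mul_sum]
        exact Finset.sum_congr rfl fun k _ => by ring
    _ = 0 := Finset.sum_eq_zero fun i _ => by rw [hrat, mul_zero]

end Binomials

/-! ### The Gibbs inequality and the row space of a matrix -/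

/-- The Gibbs inequality, in one term. -/
theorem Real.mul_log_sub_log_le {p q : ℝ} (hp : 0 ≤ p) (hq : 0 ≤ q) (hpq : p ≠ 0 → q ≠ 0) :
    p * (Real.log q - Real.log p) ≤ q - p := by
  rcases hp.eq_or_lt with rfl | hp
  · simpa using hq
  · have hq : 0 < q := hq.lt_of_ne' (hpq hp.ne')
    have h := Real.log_le_sub_one_of_pos (div_pos hq hp)
    rw [Real.log_div hq.ne' hp.ne'] at h
    calc _ ≤ p * (q / p - 1) := mul_le_mul_of_nonneg_left h hp.le
      _ = q - p := by field_simp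

theorem Real.eq_of_mul_log_sub_log_eq {p q : ℝ} (hp : 0 ≤ p) (hq : 0 ≤ q) (hpq : p ≠ 0 → q ≠ 0)
    (h : p * (Real.log q - Real.log p) = q - p) : p = q := by
  rcases hp.eq_or_lt with rfl | hp
  · linarith
  · have hq : 0 < q := hq.lt_of_ne' (hpq hp.ne')
    by_contra hne
    have hlt := Real.log_lt_sub_one_of_pos (div_pos hq hp)
      (fun h1 => hne ((div_eq_one_iff_eq hp.ne').1 h1).symm)
    rw [Real.log_div hq.ne' hp.ne'] at hlt
    have := mul_lt_mul_of_pos_left hlt hp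
    rw [mul_sub p (q / p), mul_div_cancel₀ _ hp.ne', mul_one] at this
    linarith

/-- A vector orthogonal to the kernel of `A` lies in the row space of `A`. -/
theorem Matrix.exists_transpose_mulVec_eq {L K : Type*} [Fintype L] [Fintype K]
    (A : Matrix L K ℝ) {g : K → ℝ} (hg : ∀ w, A *ᵥ w = 0 → g ⬝ᵥ w = 0) :
    ∃ ζ : L → ℝ, Aᵀ *ᵥ ζ = g := by
  classical
  let F : (K → ℝ) → (K → ℝ) →ₗ[ℝ] ℝ := fun v => dotProductBilin ℝ ℝ v
  have h := mem_span_of_iInf_ker_le_ker (L := fun l => F (A l)) (K := F g) (by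
    intro w hw
    refine hg w (funext fun l => ?_)
    exact (Submodule.mem_iInf _).1 hw l)
  obtain ⟨ζ, hζ⟩ := (Submodule.mem_span_range_iff_exists_fun ℝ).1 h
  refine ⟨ζ, funext fun k => ?_⟩
  have := congrArg (fun f => f (Pi.single k 1)) hζ
  simp only [F, LinearMap.sum_apply, LinearMap.smul_apply, dotProductBilin_apply_apply,
    dotProduct_single, mul_one, smul_eq_mul] at this
  rw [← this]
  simp [mulVec, dotProduct, mul_comm]

/-! ### Perturbations of positive vectors -/

/-- A positive vector stays positive under small perturbations in a fixed direction. -/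
theorem eventually_pos_add_mul {K : Type*} [Finite K] {y : K → ℝ} (hy : ∀ k, 0 < y k)
    (w : K → ℝ) : ∀ᶠ s : ℝ in nhds 0, ∀ k, 0 < y k + s * w k := by
  refine Filter.eventually_all.2 fun k => ?_
  have hc : Continuous fun s : ℝ => y k + s * w k := by fun_prop
  exact hc.continuousAt.eventually (lt_mem_nhds (by simpa using hy k))

theorem exists_pos_forall_nonneg_add_smul {K : Type*} [Finite K] {y : K → ℝ} (hy : ∀ k, 0 < y k)
    (w : K → ℝ) : ∃ ε : ℝ, 0 < ε ∧ ∀ k, 0 ≤ (y + ε • w) k := by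
  obtain ⟨δ, hδ, h⟩ := Metric.eventually_nhds_iff.1 (eventually_pos_add_mul hy w)
  refine ⟨δ / 2, by positivity, fun k => (h ?_ k).le⟩
  rw [Real.dist_0_eq_abs, abs_of_pos (by positivity)]
  linarith

namespace P1

variable {n : ℕ} {R : Reciprocity}

/-! ### The simplices, the marginal polytope and the marginal cone -/

theorem mem_dyadSimplex {p : Cell n → ℝ} :
    p ∈ dyadSimplex n ↔ (∀ k, 0 ≤ p k) ∧ ∀ d, ∑ s, p (d, s) = 1 :=
  ⟨fun h => ⟨fun k => (h k.1).1 k.2, fun d => (h d).2⟩, fun h d => ⟨fun s => h.1 (d, s), h.2 d⟩⟩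

theorem moment_add (p q : Cell n → ℝ) : moment n R (p + q) = moment n R p + moment n R q :=
  mulVec_add _ _ _

theorem moment_sub (p q : Cell n → ℝ) : moment n R (p - q) = moment n R p - moment n R q :=
  mulVec_sub _ _ _

theorem moment_smul (c : ℝ) (p : Cell n → ℝ) : moment n R (c • p) = c • moment n R p :=
  mulVec_smul _ _ _

theorem continuous_moment : Continuous (moment n R) :=
  Continuous.matrix_mulVec continuous_const continuous_id

/-- The row of `λ_d` in the design matrix sums the four coordinates of the dyad `d`. -/
theorem moment_inl (p : Cell n → ℝ) (d : Dyad n) : moment n R p (.inl d) = ∑ s, p (d, s) := by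
  simp only [moment, design, mulVec, dotProduct, map_apply, designNat, Fintype.sum_prod_type]
  rw [Finset.sum_eq_single d]
  · simp
  · intro d' _ hd
    simp [hd.symm]
  · simp

/-- The fibers of the moment map on the non-negative orthant do not leave `D_n`. -/
theorem mem_dyadSimplex_of_moment_eq {p q : Cell n → ℝ} (hp : p ∈ dyadSimplex n)
    (hq : ∀ k, 0 ≤ q k) (h : moment n R q = moment n R p) : q ∈ dyadSimplex n := by
  refine mem_dyadSimplex.2 ⟨hq, fun d => ?_⟩
  rw [← moment_inl (R := R), h, moment_inl, (mem_dyadSimplex.1 hp).2]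

theorem sum_eq_zero_of_moment_eq_zero {w : Cell n → ℝ} (h : moment n R w = 0) :
    ∑ k, w k = 0 := by
  rw [Fintype.sum_prod_type]
  exact Finset.sum_eq_zero fun d _ => by rw [← moment_inl (R := R), h, Pi.zero_apply]

theorem convex_dyadSimplex : Convex ℝ (dyadSimplex n) := by
  intro p hp q hq a b ha hb hab d
  exact convex_stdSimplex ℝ _ (hp d) (hq d) ha hb hab

theorem isCompact_dyadSimplex : IsCompact (dyadSimplex n) := by
  have h1 : IsClosed (dyadSimplex n) := by
    have : dyadSimplex n = ⋂ d, (fun p : Cell n → ℝ => fun s => p (d, s)) ⁻¹'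
        stdSimplex ℝ (Fin 2 × Fin 2) := by
      ext p
      simp [dyadSimplex]
    rw [this]
    exact isClosed_iInter fun d => (isClosed_stdSimplex ℝ _).preimage (by fun_prop)
  refine isCompact_Icc.of_isClosed_subset h1 (fun p hp => ?_ : dyadSimplex n ⊆ Set.Icc 0 1)
  obtain ⟨h0, h1⟩ := mem_dyadSimplex.1 hp
  refine ⟨h0, fun k => ?_⟩
  rw [Pi.one_apply, ← h1 k.1]
  exact Finset.single_le_sum (f := fun s => p (k.1, s)) (fun s _ => h0 _) (Finset.mem_univ k.2)

theorem convex_marginalPolytope : Convex ℝ (marginalPolytope n R) := by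
  rintro _ ⟨p, hp, rfl⟩ _ ⟨q, hq, rfl⟩ a b ha hb hab
  exact ⟨a • p + b • q, convex_dyadSimplex hp hq ha hb hab, by
    rw [moment_add, moment_smul, moment_smul]⟩

theorem convex_marginalCone : Convex ℝ (marginalCone n R) := by
  rintro _ ⟨p, hp, rfl⟩ _ ⟨q, hq, rfl⟩ a b ha hb _
  refine ⟨a • p + b • q, fun k => ?_, by rw [mulVec_add, mulVec_smul, mulVec_smul]⟩
  exact add_nonneg (mul_nonneg ha (hp k)) (mul_nonneg hb (hq k))

theorem exists_mem_dyadSimplex_support {F : Set (Cell n)} (hF : ∀ d, ∃ s, (d, s) ∈ F) :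
    ∃ q ∈ dyadSimplex n, Function.support q = F := by
  classical
  have hN : ∀ d : Dyad n, 0 < (({s | (d, s) ∈ F} : Finset (Fin 2 × Fin 2)).card : ℝ) := fun d => by
    obtain ⟨s, hs⟩ := hF d
    exact_mod_cast Finset.card_pos.2 ⟨s, by simpa using hs⟩
  refine ⟨fun k => if k ∈ F then
    (({s | (k.1, s) ∈ F} : Finset (Fin 2 × Fin 2)).card : ℝ)⁻¹ else 0, ?_, ?_⟩
  · refine mem_dyadSimplex.2 ⟨fun k => ?_, fun d => ?_⟩
    · split_ifs <;> positivity
    · rw [← Finset.sum_filter]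
      refine (Finset.sum_const
        (({s | (d, s) ∈ F} : Finset (Fin 2 × Fin 2)).card : ℝ)⁻¹).trans ?_
      rw [nsmul_eq_mul]
      exact mul_inv_cancel₀ (hN d).ne'
  · ext k
    by_cases hk : k ∈ F
    · simpa [hk] using (hN k.1).ne'
    · simp [hk]

theorem exists_pos_mem_dyadSimplex (n : ℕ) : ∃ u ∈ dyadSimplex n, ∀ k, 0 < u k := by
  obtain ⟨u, hu, hs⟩ := exists_mem_dyadSimplex_support (n := n) (F := Set.univ)
    fun _ => ⟨0, trivial⟩
  refine ⟨u, hu, fun k => ((mem_dyadSimplex.1 hu).1 k).lt_of_ne' ?_⟩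
  have : k ∈ Function.support u := hs ▸ trivial
  exact this

/-- If the segment from `moment q` to `t` can be prolonged beyond `t` to a point `moment z`, then
`t` is the moment of a proper convex combination of `z` and `q`. -/
theorem moment_convexCombo {ε : ℝ} (hε : 0 < ε) {t : Param n R → ℝ} {q z : Cell n → ℝ}
    (h : t + ε • (t - moment n R q) = moment n R z) :
    moment n R ((1 / (1 + ε)) • z + (ε / (1 + ε)) • q) = t := by
  rw [moment_add, moment_smul, moment_smul, ← h]
  match_scalars <;> field_simp
  ring

theorem mem_intrinsicInterior_marginalCone {t : Param n R → ℝ} :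
    t ∈ intrinsicInterior ℝ (marginalCone n R) ↔ ∃ y, (∀ k, 0 < y k) ∧ moment n R y = t := by
  rw [convex_marginalCone.mem_intrinsicInterior_iff]
  constructor
  · rintro ⟨-, h⟩
    obtain ⟨ε, hε, z, hz, h⟩ := h (moment n R 1) ⟨1, fun _ => zero_le_one, rfl⟩
    refine ⟨_, fun k => ?_, moment_convexCombo hε h⟩
    have h1 : 0 ≤ (1 / (1 + ε)) * z k := mul_nonneg (by positivity) (hz k)
    have h2 : 0 < (ε / (1 + ε)) * (1 : ℝ) := by positivity
    exact add_pos_of_nonneg_of_pos h1 h2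
  · rintro ⟨y, hy, rfl⟩
    refine ⟨⟨y, fun k => (hy k).le, rfl⟩, ?_⟩
    rintro _ ⟨x, hx, rfl⟩
    obtain ⟨ε, hε, h⟩ := exists_pos_forall_nonneg_add_smul hy (y - x)
    exact ⟨ε, hε, _, h, by rw [mulVec_add, mulVec_smul, mulVec_sub]; rfl⟩

theorem mem_intrinsicInterior_marginalPolytope {t : Param n R → ℝ} :
    t ∈ intrinsicInterior ℝ (marginalPolytope n R) ↔
      ∃ y ∈ dyadSimplex n, (∀ k, 0 < y k) ∧ moment n R y = t := by
  rw [convex_marginalPolytope.mem_intrinsicInterior_iff]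
  constructor
  · rintro ⟨-, h⟩
    obtain ⟨u, hu, hpos⟩ := exists_pos_mem_dyadSimplex n
    obtain ⟨ε, hε, z, hz, h⟩ := h (moment n R u) ⟨u, hu, rfl⟩
    refine ⟨_, convex_dyadSimplex hz hu (by positivity) (by positivity) (by field_simp),
      fun k => ?_, moment_convexCombo hε h⟩
    have h1 : 0 ≤ (1 / (1 + ε)) * z k := mul_nonneg (by positivity) ((mem_dyadSimplex.1 hz).1 k)
    have h2 : 0 < (ε / (1 + ε)) * u k := mul_pos (by positivity) (hpos k)
    exact add_pos_of_nonneg_of_pos h1 h2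
  · rintro ⟨y, hyD, hy, rfl⟩
    refine ⟨⟨y, hyD, rfl⟩, ?_⟩
    rintro _ ⟨x, hx, rfl⟩
    obtain ⟨ε, hε, h⟩ := exists_pos_forall_nonneg_add_smul hy (y - x)
    refine ⟨ε, hε, _, mem_dyadSimplex.2 ⟨h, fun d => ?_⟩, by
      rw [moment_add, moment_smul, moment_sub]⟩
    simp [Finset.sum_add_distrib, ← Finset.mul_sum, (mem_dyadSimplex.1 hyD).2 d,
      (mem_dyadSimplex.1 hx).2 d]

theorem mem_intrinsicInterior_polytope_iff_cone {t : Param n R → ℝ}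
    (ht : t ∈ marginalPolytope n R) :
    t ∈ intrinsicInterior ℝ (marginalPolytope n R) ↔
      t ∈ intrinsicInterior ℝ (marginalCone n R) := by
  rw [mem_intrinsicInterior_marginalPolytope, mem_intrinsicInterior_marginalCone]
  obtain ⟨p, hp, rfl⟩ := ht
  exact ⟨fun ⟨y, _, hy, h⟩ => ⟨y, hy, h⟩, fun ⟨y, hy, h⟩ =>
    ⟨y, mem_dyadSimplex_of_moment_eq hp (fun k => (hy k).le) h, hy, h⟩⟩

/-! ### The model and the toric variety -/

theorem isBinomialZero_of_mem_closedModel {p : Cell n → ℝ} (hp : p ∈ closedModel n R) :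
    IsBinomialZero (designNat n R) p := by
  intro u v huv
  have hmon : ∀ u : Cell n → ℕ, MvPolynomial.aeval (R := ℝ)
      (fun k : Cell n => ∏ l : Param n R,
        (MvPolynomial.X l : MvPolynomial (Param n R) ℝ) ^ designNat n R l k)
      (∏ k, (MvPolynomial.X k : MvPolynomial (Cell n) ℝ) ^ u k) =
      ∏ l, (MvPolynomial.X l : MvPolynomial (Param n R) ℝ) ^ (designNat n R *ᵥ u) l := by
    intro u
    simp only [map_prod, map_pow, MvPolynomial.aeval_X, ← Finset.prod_pow, ← pow_mul]
    rw [Finset.prod_comm]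
    simp only [Finset.prod_pow_eq_pow_sum, mulVec, dotProduct]
  have h := hp.1.2 (∏ k, MvPolynomial.X k ^ u k - ∏ k, MvPolynomial.X k ^ v k) (by
    rw [toricIdeal, RingHom.mem_ker, map_sub, hmon, hmon, huv, sub_self])
  simpa [sub_eq_zero] using h

theorem model_subset_closedModel : model n R ⊆ closedModel n R := by
  rintro p ⟨hp, hpos, ζ, hζ⟩
  refine ⟨⟨fun k => (hpos k).le, fun f hf => ?_⟩, hp⟩
  have hpk : ∀ k, p k = ∏ l, Real.exp (ζ l) ^ designNat n R l k := by
    intro k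
    rw [← Real.exp_log (hpos k), hζ]
    simp only [mulVec, dotProduct, transpose_apply, design, map_apply, Real.exp_sum,
      ← Real.exp_nat_mul]
  have h1 := congrArg (MvPolynomial.eval fun l => Real.exp (ζ l)) (RingHom.mem_ker.1 hf)
  rw [map_zero] at h1
  rw [← h1, ← MvPolynomial.coe_aeval_eq_eval, ← MvPolynomial.coe_aeval_eq_eval]
  change _ = ((MvPolynomial.aeval fun l => Real.exp (ζ l)).comp (MvPolynomial.aeval _)) f
  rw [MvPolynomial.comp_aeval]
  simp only [map_prod, map_pow, MvPolynomial.aeval_X, ← hpk]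
  rfl

theorem isClosed_closedModel : IsClosed (closedModel n R) := by
  refine IsClosed.inter ?_ isCompact_dyadSimplex.isClosed
  simp only [toricVariety, Set.ofPred_and, Set.ofPred_forall]
  refine IsClosed.inter (isClosed_iInter fun k => isClosed_le (by fun_prop) (by fun_prop)) ?_
  exact isClosed_biInter fun f _ => isClosed_eq (MvPolynomial.continuous_eval f) continuous_const

theorem closure_model_subset_closedModel : closure (model n R) ⊆ closedModel n R :=
  closure_minimal model_subset_closedModel isClosed_closedModel

/-- The support of a point of `S_A` contains the supports of all points of its fiber under the
moment map. -/
theorem ne_zero_of_moment_eq {p x : Cell n → ℝ} (hp : p ∈ closedModel n R)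
    (hx : x ∈ dyadSimplex n) (h : moment n R x = moment n R p) {k : Cell n} (hk : x k ≠ 0) :
    p k ≠ 0 := by
  intro hpk
  have hxk := ((mem_dyadSimplex.1 hx).1 k).lt_of_ne' hk
  refine (isBinomialZero_of_mem_closedModel hp).ne_zero_of_neg (w := p - x) (k := k) ?_ ?_ ?_ hpk
  · exact (moment_sub p x).trans (sub_eq_zero.2 h.symm)
  · intro j hj hpj
    have := (mem_dyadSimplex.1 hx).1 j
    rw [Pi.sub_apply, hpj] at hj
    linarith
  · rw [Pi.sub_apply, hpk]
    linarith

/-! ### The moment map is onto: entropy maximization -/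

/-- A point of maximal entropy in the fiber of a strictly positive point of `D_n` is strictly
positive: towards a strictly positive point the entropy has an infinite slope at the boundary. -/
theorem pos_of_isMaxOn_entropy {x p : Cell n → ℝ} (hx : ∀ k, 0 < x k)
    (hxD : x ∈ dyadSimplex n) (hp : p ∈ dyadSimplex n) (hpx : moment n R p = moment n R x)
    (hmax : ∀ q ∈ dyadSimplex n, moment n R q = moment n R x →
      ∑ k, Real.negMulLog (q k) ≤ ∑ k, Real.negMulLog (p k)) (k : Cell n) : 0 < p k := by
  have hp0 := (mem_dyadSimplex.1 hp).1
  refine (hp0 k).lt_of_ne' fun hk => ?_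
  let H : (Cell n → ℝ) → ℝ := fun q => ∑ k, Real.negMulLog (q k)
  let c : ℝ := ∑ j, if p j = 0 then x j else 0
  have hc : 0 < c := by
    refine Finset.sum_pos' (fun j _ => ?_) ⟨k, Finset.mem_univ k, by simpa [hk] using hx k⟩
    split_ifs
    exacts [(hx j).le, le_rfl]
  have key : ∀ s : ℝ, 0 < s → s < 1 → c * -Real.log s ≤ H p - H x := by
    intro s hs hs1
    have h1 : (1 - s) * H p + s * H x + c * (-s * Real.log s) ≤
        H ((1 - s) • p + s • x) := by
      simp only [H, c, Finset.mul_sum, Finset.sum_mul]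
      rw [← Finset.sum_add_distrib, ← Finset.sum_add_distrib]
      refine Finset.sum_le_sum fun j _ => ?_
      split_ifs with hj
      · have := Real.negMulLog_mul s (x j)
        simp only [hj, Pi.add_apply, Pi.smul_apply, smul_eq_mul, mul_zero, zero_add,
          Real.negMulLog_zero, this]
        simp only [Real.negMulLog]
        linarith
      · have := Real.concaveOn_negMulLog.2 (hp0 j) (hx j).le (sub_nonneg.2 hs1.le) hs.le (by ring)
        simpa using this
    have h2 : H ((1 - s) • p + s • x) ≤ H p := by
      refine hmax _ (convex_dyadSimplex hp hxD (sub_nonneg.2 hs1.le) hs.le (by ring)) ?_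
      rw [moment_add, moment_smul, moment_smul, hpx, ← add_smul, sub_add_cancel, one_smul]
    refine le_of_mul_le_mul_left ?_ hs
    linarith
  have hD : 0 ≤ H p - H x := sub_nonneg.2 (hmax x hxD rfl)
  have := key (Real.exp (-((H p - H x) / c + 1))) (Real.exp_pos _) (by
    rw [Real.exp_lt_one_iff]
    have : 0 ≤ (H p - H x) / c := by positivity
    linarith)
  rw [Real.log_exp, neg_neg, mul_add, mul_div_cancel₀ _ hc.ne'] at this
  linarith

/-- The fiber of a strictly positive point of `D_n` meets the model, in the point of maximal
entropy. -/
theorem exists_mem_model_of_pos {x : Cell n → ℝ} (hxD : x ∈ dyadSimplex n) (hx : ∀ k, 0 < x k) :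
    ∃ p ∈ model n R, moment n R p = moment n R x := by
  obtain ⟨p, ⟨hp, hpx⟩, hmax⟩ :=
    (isCompact_dyadSimplex.inter_right (isClosed_singleton.preimage continuous_moment)
      : IsCompact (dyadSimplex n ∩ moment n R ⁻¹' {moment n R x})).exists_isMaxOn ⟨x, hxD, rfl⟩
      (f := fun q => ∑ k, Real.negMulLog (q k)) (by fun_prop)
  have hpos := pos_of_isMaxOn_entropy hx hxD hp hpx fun q hq hqx => hmax ⟨hq, hqx⟩
  refine ⟨p, ⟨hp, hpos, ?_⟩, hpx⟩
  -- the gradient of the entropy at `p` is orthogonal to the kernel of the design matrix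
  obtain ⟨ζ, hζ⟩ := (design n R).exists_transpose_mulVec_eq (g := fun k => Real.log (p k)) (by
    intro w hw
    have hmom : ∀ s : ℝ, moment n R (p + s • w) = moment n R x := fun s => by
      rw [moment_add, moment_smul, show moment n R w = 0 from hw, smul_zero, add_zero, hpx]
    have hloc : IsLocalMax (fun s : ℝ => ∑ k, Real.negMulLog (p k + s * w k)) 0 := by
      filter_upwards [eventually_pos_add_mul hpos w] with s hs
      have := hmax (a := p + s • w)
        ⟨mem_dyadSimplex_of_moment_eq (R := R) hp (fun k => (hs k).le) ((hmom s).trans hpx.symm),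
          hmom s⟩
      simpa using this
    have hder : HasDerivAt (fun s : ℝ => ∑ k, Real.negMulLog (p k + s * w k))
        (∑ k, (-Real.log (p k) - 1) * w k) 0 := by
      refine HasDerivAt.fun_sum fun k _ => ?_
      have h1 : HasDerivAt (fun s : ℝ => p k + s * w k) (w k) 0 := by
        simpa using ((hasDerivAt_id (0 : ℝ)).mul_const (w k)).const_add (p k)
      have h2 : HasDerivAt Real.negMulLog (-Real.log (p k) - 1) (p k + 0 * w k) := by
        simpa using Real.hasDerivAt_negMulLog (hpos k).ne'
      exact h2.comp (0 : ℝ) h1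
    have h0 := hloc.hasDerivAt_eq_zero hder
    simp only [sub_mul, neg_mul, one_mul, Finset.sum_sub_distrib, Finset.sum_neg_distrib,
      sum_eq_zero_of_moment_eq_zero hw, sub_zero, neg_eq_zero] at h0
    exact h0)
  exact ⟨ζ, fun k => (congrFun hζ k).symm⟩

theorem exists_mem_closure_model {x : Cell n → ℝ} (hx : x ∈ dyadSimplex n) :
    ∃ p ∈ closure (model n R), moment n R p = moment n R x := by
  -- approximate `x` by strictly positive points and use compactness
  obtain ⟨u, hu, hupos⟩ := exists_pos_mem_dyadSimplex n
  have hcomp : IsCompact (moment n R '' closure (model n R)) :=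
    (isCompact_dyadSimplex.of_isClosed_subset isClosed_closure
      (closure_model_subset_closedModel.trans Set.inter_subset_right)).image continuous_moment
  have := left_nhdsWithin_Ioo_neBot (zero_lt_one (α := ℝ))
  change moment n R x ∈ moment n R '' closure (model n R)
  refine hcomp.isClosed.mem_of_tendsto (b := nhdsWithin (0 : ℝ) (Set.Ioo 0 1))
    (f := fun s => moment n R ((1 - s) • x + s • u)) ?_ ?_
  · have hc : Continuous fun s : ℝ => moment n R ((1 - s) • x + s • u) :=
      continuous_moment.comp (by fun_prop)
    simpa using (hc.tendsto 0).mono_left nhdsWithin_le_nhds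
  · filter_upwards [self_mem_nhdsWithin] with s hs
    have h0 : 0 ≤ 1 - s := sub_nonneg.2 hs.2.le
    obtain ⟨p, hp, h⟩ := exists_mem_model_of_pos (R := R)
      (convex_dyadSimplex hx hu h0 hs.1.le (by ring)) (fun k =>
        add_pos_of_nonneg_of_pos (mul_nonneg h0 ((mem_dyadSimplex.1 hx).1 k))
          (mul_pos hs.1 (hupos k)))
    exact ⟨p, subset_closure hp, h⟩

/-! ### The likelihood -/

theorem likelihood_eq_exp {x q : Cell n → ℝ} (hq : ∀ k, x k ≠ 0 → 0 < q k) :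
    likelihood n x q = Real.exp (∑ k, x k * Real.log (q k)) := by
  rw [likelihood, Real.exp_sum, Fintype.prod_prod_type]
  refine Finset.prod_congr rfl fun d _ => Finset.prod_congr rfl fun s _ => ?_
  rcases eq_or_ne (x (d, s)) 0 with h | h
  · simp [h]
  · rw [Real.rpow_def_of_pos (hq _ h), mul_comm]

theorem likelihood_eq_zero {x q : Cell n → ℝ} {k : Cell n} (hx : x k ≠ 0) (hq : q k = 0) :
    likelihood n x q = 0 :=
  Finset.prod_eq_zero (Finset.mem_univ k.1) <| Finset.prod_eq_zero (Finset.mem_univ k.2) <| by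
    rw [show q (k.1, k.2) = 0 from hq, Real.zero_rpow hx]

theorem continuous_likelihood {x : Cell n → ℝ} (hx : ∀ k, 0 ≤ x k) :
    Continuous (likelihood n x) :=
  continuous_finsetProd _ fun d _ => continuous_finsetProd _ fun s _ =>
    (Real.continuous_rpow_const (hx (d, s))).comp (continuous_apply (d, s))

/-- The likelihood equations determine the maximizer: a point `p` of `S_A` with `A p = A x` has a
larger likelihood than any other point of `S_A`. -/
theorem eq_of_likelihood_le {x p q : Cell n → ℝ} (hx : x ∈ dyadSimplex n)
    (hp : p ∈ closedModel n R) (hq : q ∈ closedModel n R) (hpx : moment n R p = moment n R x)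
    (hle : likelihood n x p ≤ likelihood n x q) : q = p := by
  have hx0 := (mem_dyadSimplex.1 hx).1
  have hxp : ∀ k, x k ≠ 0 → 0 < p k := fun k hk =>
    (hp.1.1 k).lt_of_ne' (ne_zero_of_moment_eq hp hx hpx.symm hk)
  have hxq : ∀ k, x k ≠ 0 → 0 < q k := fun k hk => by
    refine (hq.1.1 k).lt_of_ne' fun h => ?_
    rw [likelihood_eq_zero hk h, likelihood_eq_exp hxp] at hle
    exact (Real.exp_pos _).not_ge hle
  have hw : moment n R (x - p) = 0 := by rw [moment_sub, hpx, sub_self]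
  have hpq : ∀ k, p k ≠ 0 → q k ≠ 0 := by
    intro k hk h
    have hxk : x k = 0 := by
      by_contra hxk
      exact (hxq k hxk).ne' h
    refine (isBinomialZero_of_mem_closedModel hq).ne_zero_of_neg hw (fun j hj => ?_) (k := k) ?_ h
    · refine (hxq j fun hxj => ?_).ne'
      rw [Pi.sub_apply, hxj] at hj
      linarith [hp.1.1 j]
    · rw [Pi.sub_apply, hxk, zero_sub, neg_lt_zero]
      exact (hp.1.1 k).lt_of_ne' hk
  have hsupp : ∀ k, (x - p) k ≠ 0 → p k ≠ 0 := by
    intro k hk hpk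
    by_cases hxk : x k = 0
    · exact hk (by simp [hxk, hpk])
    · exact (hxp k hxk).ne' hpk
  -- the log-likelihoods of `p` and `q` do not change when the data `x` are replaced by `p`
  have h1 := (isBinomialZero_of_mem_closedModel hp).sum_mul_log hw hsupp
  have h2 := (isBinomialZero_of_mem_closedModel hq).sum_mul_log hw fun k hk => hpq k (hsupp k hk)
  rw [likelihood_eq_exp hxp, likelihood_eq_exp hxq, Real.exp_le_exp] at hle
  simp only [Pi.sub_apply, sub_mul, Finset.sum_sub_distrib] at h1 h2
  have hterm : ∀ k ∈ Finset.univ, p k * (Real.log (q k) - Real.log (p k)) ≤ q k - p k :=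
    fun k _ => Real.mul_log_sub_log_le (hp.1.1 k) (hq.1.1 k) (hpq k)
  have hsum : ∑ k, (q k - p k) = 0 := by
    simp [Fintype.sum_prod_type, (mem_dyadSimplex.1 hp.2).2, (mem_dyadSimplex.1 hq.2).2]
  have heq := (Finset.sum_eq_sum_iff_of_le hterm).1 (le_antisymm (Finset.sum_le_sum hterm) (by
    rw [hsum]
    simp only [mul_sub, Finset.sum_sub_distrib]
    linarith))
  exact funext fun k => (Real.eq_of_mul_log_sub_log_eq (hp.1.1 k) (hq.1.1 k) (hpq k)
    (heq k (Finset.mem_univ k))).symm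

theorem isMaxOn_likelihood {x p : Cell n → ℝ} (hx : x ∈ dyadSimplex n)
    (hp : p ∈ closedModel n R) (hpx : moment n R p = moment n R x) :
    IsMaxOn (likelihood n x) (closedModel n R) p := by
  intro q hq
  by_contra h
  obtain rfl := eq_of_likelihood_le hx hp hq hpx (not_le.1 h).le
  exact h (le_refl (likelihood n x q))

theorem bijOn_moment : Set.BijOn (moment n R) (closedModel n R) (marginalPolytope n R) := by
  refine ⟨fun p hp => ⟨p, hp.2, rfl⟩, fun p hp q hq h => ?_, ?_⟩
  · -- both `p` and `q` maximize the likelihood of the data `q`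
    exact eq_of_likelihood_le hq.2 hq hp rfl (isMaxOn_likelihood hq.2 hp h hq)
  · rintro _ ⟨x, hx, rfl⟩
    obtain ⟨p, hp, h⟩ := exists_mem_closure_model hx
    exact ⟨p, closure_model_subset_closedModel hp, h⟩

theorem closure_model : closure (model n R) = closedModel n R := by
  refine closure_model_subset_closedModel.antisymm fun p hp => ?_
  obtain ⟨q, hq, h⟩ := exists_mem_closure_model (R := R) hp.2
  rwa [bijOn_moment.injOn hp (closure_model_subset_closedModel hq) h.symm]

theorem momentInv_mem {t : Param n R → ℝ} (ht : t ∈ marginalPolytope n R) :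
    momentInv n R t ∈ closedModel n R :=
  Function.invFunOn_mem (bijOn_moment.surjOn ht)

theorem moment_momentInv {t : Param n R → ℝ} (ht : t ∈ marginalPolytope n R) :
    moment n R (momentInv n R t) = t :=
  Function.invFunOn_eq (bijOn_moment.surjOn ht)

theorem isExtendedMLE_momentInv {t : Param n R → ℝ} (ht : t ∈ marginalPolytope n R)
    {x : Cell n → ℝ} (hx : x ∈ dyadSimplex n) (hxt : moment n R x = t) :
    IsExtendedMLE n R x (momentInv n R t) := by
  have hmem := momentInv_mem ht
  have hmom := (moment_momentInv ht).trans hxt.symm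
  rw [IsExtendedMLE, closure_model]
  exact ⟨hmem, isMaxOn_likelihood hx hmem hmom, fun q hq hmax =>
    eq_of_likelihood_le hx hmem hq hmom (hmax hmem)⟩

theorem mleExists_iff {t : Param n R → ℝ} (ht : t ∈ marginalPolytope n R)
    {x : Cell n → ℝ} (hx : x ∈ dyadSimplex n) (hxt : moment n R x = t) :
    MLEExists n R x ↔ t ∈ intrinsicInterior ℝ (marginalCone n R) := by
  constructor
  · rintro ⟨p, hp, hmax⟩
    -- by continuity `p` is a maximizer over the closure, that is, the extended MLE
    have hmax' := hmax.closure (continuous_likelihood (mem_dyadSimplex.1 hx).1).continuousOn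
    have hpt := (isExtendedMLE_momentInv ht hx hxt).2.2 p (subset_closure hp) hmax'
    exact mem_intrinsicInterior_marginalCone.2 ⟨p, hp.2.1, hpt ▸ moment_momentInv ht⟩
  · intro h
    obtain ⟨y, hyD, hy, hyt⟩ := mem_intrinsicInterior_marginalPolytope.1
      ((mem_intrinsicInterior_polytope_iff_cone ht).2 h)
    obtain ⟨p, hp, hpy⟩ := exists_mem_model_of_pos (R := R) hyD hy
    exact ⟨p, hp, (isMaxOn_likelihood hx (model_subset_closedModel hp)
      (hpy.trans (hyt.trans hxt.symm))).on_subset model_subset_closedModel⟩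

/-! ### Faces of the marginal polytope and facial sets -/

/-- A face of `P_A` consists of the moments of the points of `D_n` that are supported in a facial
set. A functional that defines the face is turned into one that defines the facial set by
subtracting, in the coordinate `λ_d`, its largest value on the columns of the dyad `d`. -/
theorem IsFace.exists_isFacialSet {G : Set (Param n R → ℝ)} (hG : IsFace n R G) :
    ∃ F : Set (Cell n), IsFacialSet n R F ∧ (∀ d, ∃ s, (d, s) ∈ F) ∧
      ∀ p ∈ dyadSimplex n, moment n R p ∈ G ↔ Function.support p ⊆ F := by
  classical
  obtain ⟨f, hf⟩ := hG.2 hG.1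
  let c₀ : Param n R → ℝ := fun m => f fun j => if m = j then 1 else 0
  have hc₀ : ∀ v, f v = c₀ ⬝ᵥ v := by
    intro v
    refine (LinearMap.pi_apply_eq_sum_univ (f : (Param n R → ℝ) →ₗ[ℝ] ℝ) v).trans ?_
    exact Finset.sum_congr rfl fun m _ => mul_comm _ _
  let a : Cell n → ℝ := fun k => c₀ ⬝ᵥ fun l => design n R l k
  have hmax : ∀ d : Dyad n, ∃ s, ∀ s', a (d, s') ≤ a (d, s) := fun d =>
    Finite.exists_max fun s => a (d, s)
  choose s hs using hmax
  let e : Param n R → ℝ := Sum.elim (fun d => a (d, s d)) 0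
  let b : Cell n → ℝ := fun k => (c₀ - e) ⬝ᵥ fun l => design n R l k
  have he : ∀ v, e ⬝ᵥ v = ∑ d, a (d, s d) * v (.inl d) := by
    intro v
    simp [e, dotProduct, Fintype.sum_sum_type]
  have hb : ∀ k, b k = a k - a (k.1, s k.1) := by
    intro k
    simp only [b, sub_dotProduct, he]
    simp [a, design, designNat]
  have hb0 : ∀ k, b k ≤ 0 := fun k => by
    rw [hb, sub_nonpos]
    exact hs k.1 k.2
  have hsum : ∀ p ∈ dyadSimplex n, f (moment n R p) = (∑ k, b k * p k) + ∑ d, a (d, s d) := by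
    intro p hp
    have h1 : ∑ k, b k * p k = (c₀ - e) ⬝ᵥ moment n R p := by
      rw [moment, dotProduct_mulVec]
      rfl
    rw [h1, sub_dotProduct, he, hc₀]
    simp [moment_inl, (mem_dyadSimplex.1 hp).2]
  have hzero : ∀ p : Cell n → ℝ, Function.support p ⊆ {k | b k = 0} → ∑ k, b k * p k = 0 := by
    intro p hp
    refine Finset.sum_eq_zero fun k _ => ?_
    by_cases hk : p k = 0
    · rw [hk, mul_zero]
    · rw [show b k = 0 from hp hk, zero_mul]
  have hne : ∀ d, ∃ s, (d, s) ∈ {k | b k = 0} := fun d => ⟨s d, by simp [hb]⟩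
  refine ⟨{k | b k = 0}, ⟨c₀ - e, fun k hk => hk, fun k hk => (hb0 k).lt_of_ne hk⟩, hne, ?_⟩
  intro p hp
  have hp0 := (mem_dyadSimplex.1 hp).1
  constructor
  · intro hpG k hk
    obtain ⟨q, hq, hqs⟩ := exists_mem_dyadSimplex_support hne
    rw [hf] at hpG
    have h1 := hpG.2 _ ⟨q, hq, rfl⟩
    rw [hsum p hp, hsum q hq, hzero q hqs.le, add_le_add_iff_right] at h1
    have h2 : ∀ k ∈ Finset.univ, b k * p k ≤ 0 := fun k _ =>
      mul_nonpos_of_nonpos_of_nonneg (hb0 k) (hp0 k)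
    have h3 := (Finset.sum_eq_zero_iff_of_nonpos h2).1
      (le_antisymm (Finset.sum_nonpos h2) h1) k (Finset.mem_univ k)
    exact (mul_eq_zero.1 h3).resolve_right hk
  · intro hps
    rw [hf]
    refine ⟨⟨p, hp, rfl⟩, ?_⟩
    rintro _ ⟨q, hq, rfl⟩
    rw [hsum p hp, hsum q hq, hzero p hps, add_le_add_iff_right]
    exact Finset.sum_nonpos fun k _ =>
      mul_nonpos_of_nonpos_of_nonneg (hb0 k) ((mem_dyadSimplex.1 hq).1 k)

theorem IsFace.existsUnique_isFacialSet {G : Set (Param n R → ℝ)} (hG : IsFace n R G) :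
    ∃! F : Set (Cell n), IsFacialSet n R F ∧
      ∀ t ∈ intrinsicInterior ℝ G, F = Function.support (momentInv n R t) := by
  have hconv : Convex ℝ G := hG.2.convex convex_marginalPolytope
  obtain ⟨F, hF, hne, hmem⟩ := hG.exists_isFacialSet
  have key : ∀ t ∈ intrinsicInterior ℝ G, F = Function.support (momentInv n R t) := by
    intro t ht
    obtain ⟨htG, hext⟩ := hconv.mem_intrinsicInterior_iff.1 ht
    have htP := hG.2.subset htG
    have hpD := (momentInv_mem htP).2
    have hpt := moment_momentInv htP
    refine Set.Subset.antisymm ?_ ((hmem _ hpD).1 (by rwa [hpt]))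
    -- `t` is the moment of a point of `D_n` whose support is all of `F`
    obtain ⟨q, hq, hqF⟩ := exists_mem_dyadSimplex_support hne
    obtain ⟨ε, hε, hz⟩ := hext _ ((hmem q hq).2 hqF.le)
    obtain ⟨z, hzD, hzt⟩ := hG.2.subset hz
    intro k hk
    refine ne_zero_of_moment_eq (momentInv_mem htP)
      (convex_dyadSimplex hzD hq (by positivity) (by positivity) (by field_simp))
      ((moment_convexCombo hε hzt).trans hpt.symm) (ne_of_gt ?_)
    have hqk : q k ≠ 0 := by rwa [← hqF] at hk
    have h1 : 0 ≤ (1 / (1 + ε)) * z k := mul_nonneg (by positivity) ((mem_dyadSimplex.1 hzD).1 k)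
    have h2 : 0 < (ε / (1 + ε)) * q k :=
      mul_pos (by positivity) (((mem_dyadSimplex.1 hq).1 k).lt_of_ne' hqk)
    exact add_pos_of_nonneg_of_pos h1 h2
  obtain ⟨t, ht⟩ := Set.Nonempty.intrinsicInterior hconv hG.1
  exact ⟨F, ⟨hF, key⟩, fun F' hF' => (hF'.2 t ht).trans (key t ht).symm⟩

end P1

theorem theorem3p3 (n : ℕ) (R : P1.Reciprocity) :
    -- relative interiors of the marginal polytope and of the marginal cone
    (∀ t ∈ P1.marginalPolytope n R,
      (t ∈ intrinsicInterior ℝ (P1.marginalPolytope n R) ↔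
        t ∈ intrinsicInterior ℝ (P1.marginalCone n R))) ∧
    -- existence of the MLE
    (∀ t ∈ P1.marginalPolytope n R, ∀ x ∈ P1.dyadSimplex n, P1.moment n R x = t →
      (P1.MLEExists n R x ↔ t ∈ intrinsicInterior ℝ (P1.marginalCone n R))) ∧
    -- the inverse of the moment map is well defined, and it gives the extended MLE
    Set.BijOn (P1.moment n R) (P1.closedModel n R) (P1.marginalPolytope n R) ∧
    (∀ t ∈ P1.marginalPolytope n R, ∀ x ∈ P1.dyadSimplex n, P1.moment n R x = t →
      P1.IsExtendedMLE n R x (P1.momentInv n R t)) ∧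
    -- every face has its facial set, the common support of the extended MLEs
    (∀ G : Set (P1.Param n R → ℝ), P1.IsFace n R G →
      ∃! F : Set (P1.Cell n), P1.IsFacialSet n R F ∧
        ∀ t ∈ intrinsicInterior ℝ G, F = Function.support (P1.momentInv n R t)) :=
  ⟨fun _ ht => P1.mem_intrinsicInterior_polytope_iff_cone ht,
    fun _ ht _ hx hxt => P1.mleExists_iff ht hx hxt, P1.bijOn_moment,
    fun _ ht _ hx hxt => P1.isExtendedMLE_momentInv ht hx hxt,
    fun _ hG => hG.existsUnique_isFacialSet⟩
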